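/- Work in second-order arithmetic with the base theory $\mathsf{RCA}_0$ (basic arithmetic, $\Sigma^0_1$ induction, $\Delta^0_1$ comprehension). Let $\mathcal P_{\mathrm f}(A)$ be the set of (codes of) finite subsets of $A$. For a quasi-order $Q$ let $\mathcal P_{\mathrm f}^\flat(Q)$ and $\mathcal P_{\mathrm f}^\sharp(Q)$ be $\mathcal P_{\mathrm f}(Q)$ with the quasi-orders $$A\le^\flat B \iff (\forall a\in A)(\exists b\in B)(a\le_Q b),\qquad A\le^\sharp B\iff (\forall b\in B)(\exists a\in A)(a\le_Q b).$$ A countable second-countable space consists of a set $X$, a sequence $(U_i)_{i\in I}$ of subsets of $X$ covering $X$, and a function $k:X\times I\times I\to I$ with $x\in U_{k(x,i,j)}\subseteq U_i\cap U_j$ whenever $x\in U_i\cap U_j$. For a quasi-order $P$, the space $\mathrm{upper}(P)$ has point set $P$, index set $I=\mathcal P_{\mathrm f}(P)$, basic open sets $U_i=\{x\in P: (\forall p\in i)\; x\not\le_P p\}$, and $k(x,i,j)=i\cup j$. A general second-countable space is given by a set $I$ and formulas "$X$ is a point", "$X$ and $Y$ are the same point", "the point $X$ lies in the basic open set $i\in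 I$", in which the points are sets, such that: every point lies in a basic open set; if a point lies in the basic open sets $i$ and $j$, then it lies in some basic open set $k$ such that every set satisfying the formula for $k$ satisfies those for $i$ and $j$; and membership in basic open sets respects sameness of points. The spaces $\mathrm{upper}(\mathcal P^\flat(Q))$ and $\mathrm{upper}(\mathcal P^\sharp(Q))$ have as points the subsets $X\subseteq Q$ (two points being the same if they are equal as sets) and index set $I=\mathcal P_{\mathrm f}(Q)$; the point $X$ lies in the basic open set $i$ if and only if $(\forall q\in i)(\exists p\in X)(q\le_Q p)$ in the case of $\flat$, and $(\forall q\in i)\neg(\exists p\in X)(p\le_Q q)$ in the case of $\sharp$. In either kind of space, a function $g:\mathbb N\times\mathbb N\to\mathcal P_{\mathrm f}(I)$ codes the sequence $(F_n)_{n\in\mathbb N}$ of effectively closed sets, where $F_n$ consists of the points that for no $m$ and no $i\in g(n,m)$ lie in the basic open set $i$. The space is Noetherian if for every such sequence with $F_n\supseteq F_{n+1}$ for all $n$ there is an $N$ with $F_n=F_N$ for all $n>N$. **Theorem.** $\mathsf{RCA}_0$ proves the following (equivalently, it holds in every model $(M,S)$ of $\mathsf{RCA}_0$, possibly with nonstandard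 first-order part $M$ and with set quantifiers ranging over $S\subseteq\mathcal P(M)$). Let $Q$ be a quasi-order. Then $\mathcal P_{\mathrm f}^\flat(Q)$ and $\mathcal P_{\mathrm f}^\sharp(Q)$ are quasi-orders, $\mathrm{upper}(\mathcal P_{\mathrm f}^\flat(Q))$ and $\mathrm{upper}(\mathcal P_{\mathrm f}^\sharp(Q))$ are countable second-countable spaces, $\mathrm{upper}(\mathcal P^\flat(Q))$ and $\mathrm{upper}(\mathcal P^\sharp(Q))$ are second-countable spaces, and 1. if $\mathrm{upper}(\mathcal P^\flat(Q))$ is Noetherian, then $\mathrm{upper}(\mathcal P_{\mathrm f}^\flat(Q))$ is Noetherian; 2. if $\mathrm{upper}(\mathcal P^\sharp(Q))$ is Noetherian, then $\mathrm{upper}(\mathcal P_{\mathrm f}^\sharp(Q))$ is Noetherian. -/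

import Mathlib

/-! Second-order arithmetic with Henkin semantics. A structure for the language of second-order
arithmetic consists of a number part `M` (with `0, 1, +, *, <`) and a collection `S` of subsets
of `M` over which the set quantifiers range. A statement is a theorem of a theory if and only if
it holds in every structure satisfying the axioms (Gödel completeness), so "provable in RCA₀" is
rendered by "true in every model `(M, S)` of RCA₀". In all definitions below, number quantifiers
range over `M` and set quantifiers range over `S`. -/

namespace SOA

universe u

/-- Number terms whose free number variables are indexed by `Fin n`. -/
inductive NumTerm (n : ℕ) : Type
  | var (i : Fin n) : NumTerm n
  | zero : NumTerm n
  | one : NumTerm n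
  | add (s t : NumTerm n) : NumTerm n
  | mul (s t : NumTerm n) : NumTerm n

/-- Bounded-quantifier formulas with free number variables indexed by `Fin n` and free set
variables indexed by `ℕ`. In `ball t φ`, i.e. `(∀ x < t) φ`, the bound variable is the variable
`0` of `φ`, and the variable `i` of `t` is the variable `i + 1` of `φ`. The other connectives and
the bounded existential quantifier are the usual classical abbreviations. -/
inductive BddFormula : ℕ → Type
  | eq {n : ℕ} (s t : NumTerm n) : BddFormula n
  | lt {n : ℕ} (s t : NumTerm n) : BddFormula n
  | mem {n : ℕ} (t : NumTerm n) (X : ℕ) : BddFormula n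
  | neg {n : ℕ} (φ : BddFormula n) : BddFormula n
  | and {n : ℕ} (φ ψ : BddFormula n) : BddFormula n
  | ball {n : ℕ} (t : NumTerm n) (φ : BddFormula (n + 1)) : BddFormula n

section Semantics

variable {M : Type u} [CommSemiring M] [LinearOrder M]

/-- The value of a term. -/
def NumTerm.eval {n : ℕ} (e : Fin n → M) : NumTerm n → M
  | .var i => e i
  | .zero => 0
  | .one => 1
  | .add s t => s.eval e + t.eval e
  | .mul s t => s.eval e * t.eval e

/-- Satisfaction of a bounded formula, under an assignment `E` of sets to the set variables
and `e` of numbers to the number variables. -/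
def BddFormula.Holds (E : ℕ → Set M) : {n : ℕ} → BddFormula n → (Fin n → M) → Prop
  | _, .eq s t, e => s.eval e = t.eval e
  | _, .lt s t, e => s.eval e < t.eval e
  | _, .mem t X, e => t.eval e ∈ E X
  | _, .neg φ, e => ¬ φ.Holds E e
  | _, .and φ ψ, e => φ.Holds E e ∧ ψ.Holds E e
  | _, .ball t φ, e => ∀ a : M, a < t.eval e → φ.Holds E (Matrix.vecCons a e)

/-- `(M, S)` is a model of RCA₀: `M` is a discretely ordered commutative semiring with identity
(with least element `0`), and `(M, S)` satisfies the `Σ⁰₁` induction scheme and the `Δ⁰₁`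
comprehension scheme. A `Σ⁰₁` (respectively `Π⁰₁`) formula is `∃ y θ` (respectively `∀ y θ`)
with `θ` a bounded formula; `e` and `E` are the number and set parameters. -/
structure ModelsRCA0 [IsStrictOrderedRing M] (S : Set (Set M)) : Prop where
  zero_le : ∀ x : M, 0 ≤ x
  discrete : ∀ x y : M, x < y + 1 ↔ x ≤ y
  sigma_induction : ∀ (n : ℕ) (θ : BddFormula (n + 2)) (E : ℕ → Set M) (e : Fin n → M),
    (∀ i, E i ∈ S) →
    (∃ y, θ.Holds E (Matrix.vecCons y (Matrix.vecCons 0 e))) →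
    (∀ x, (∃ y, θ.Holds E (Matrix.vecCons y (Matrix.vecCons x e))) →
      ∃ y, θ.Holds E (Matrix.vecCons y (Matrix.vecCons (x + 1) e))) →
    ∀ x, ∃ y, θ.Holds E (Matrix.vecCons y (Matrix.vecCons x e))
  delta_comprehension : ∀ (n : ℕ) (θ ψ : BddFormula (n + 2)) (E : ℕ → Set M) (e : Fin n → M),
    (∀ i, E i ∈ S) →
    (∀ x, (∃ y, θ.Holds E (Matrix.vecCons y (Matrix.vecCons x e))) ↔
      ∀ y, ψ.Holds E (Matrix.vecCons y (Matrix.vecCons x e))) →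
    {x : M | ∃ y, θ.Holds E (Matrix.vecCons y (Matrix.vecCons x e))} ∈ S

/-! ### Coding of pairs, finite sets and functions -/

/-- The pairing function of second-order arithmetic. -/
def pair (x y : M) : M := (x + y) * (x + y) + x

/-- The Cartesian product, as a set of codes of pairs. -/
def cprod (A B : Set M) : Set M := {z | ∃ a ∈ A, ∃ b ∈ B, z = pair a b}

/-- `F` is (the graph of) a function from `A` to `B`. -/
def IsFunction (F A B : Set M) : Prop :=
  F ⊆ cprod A B ∧ ∀ a ∈ A, ∃! b, pair a b ∈ F

/-- The number `i` is an element of the finite set described by the number `c = (k, (m, n))`,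
namely the set of all `i < k` such that `m (i + 1) + 1` divides `n`. -/
def FinMem (i c : M) : Prop :=
  ∃ k m n : M, c = pair k (pair m n) ∧ i < k ∧ (m * (i + 1) + 1) ∣ n

/-- `c` is the code of a finite set: the least number describing that set. -/
def IsFinCode (c : M) : Prop :=
  ∀ d < c, ∃ i, ¬ (FinMem i d ↔ FinMem i c)

/-- The set of (codes of) finite subsets of `A`. -/
def Pf (A : Set M) : Set M :=
  {c | IsFinCode c ∧ ∀ i, FinMem i c → i ∈ A}

end Semantics

/-! ### Quasi-orders -/

/-- A set with a binary relation on it, the relation being a set of codes of pairs. -/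
structure RelSet (M : Type u) where
  carrier : Set M
  rel : Set M

section Spaces

variable {M : Type u} [CommSemiring M] [LinearOrder M]

/-- The relation `x ≤_Q y`. -/
def RelSet.Le (Q : RelSet M) (x y : M) : Prop := pair x y ∈ Q.rel

/-- `Q` is a quasi-order in the sense of `(M, S)`. -/
structure IsQuasiOrder (S : Set (Set M)) (Q : RelSet M) : Prop where
  carrier_mem : Q.carrier ∈ S
  rel_mem : Q.rel ∈ S
  rel_subset : Q.rel ⊆ cprod Q.carrier Q.carrier
  refl : ∀ x ∈ Q.carrier, Q.Le x x
  trans : ∀ x ∈ Q.carrier, ∀ y ∈ Q.carrier, ∀ z ∈ Q.carrier, Q.Le x y → Q.Le y z → Q.Le x z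

/-- The quasi-order `P_f^♭(Q)` on the finite subsets of `Q`. -/
def PfFlat (Q : RelSet M) : RelSet M where
  carrier := Pf Q.carrier
  rel := {z | ∃ a ∈ Pf Q.carrier, ∃ b ∈ Pf Q.carrier, z = pair a b ∧
    ∀ x, FinMem x a → ∃ y, FinMem y b ∧ Q.Le x y}

/-- The quasi-order `P_f^♯(Q)` on the finite subsets of `Q`. -/
def PfSharp (Q : RelSet M) : RelSet M where
  carrier := Pf Q.carrier
  rel := {z | ∃ a ∈ Pf Q.carrier, ∃ b ∈ Pf Q.carrier, z = pair a b ∧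
    ∀ y, FinMem y b → ∃ x, FinMem x a ∧ Q.Le x y}

/-! ### Countable second-countable spaces -/

/-- The data of a countable second-countable space: a set `X` of points, a set `I` of indices,
a sequence `(U_i)_{i ∈ I}` of subsets of `X` coded by the set `U = {(x, i) : x ∈ U_i}`, and a
function `k : X × I × I → I`. -/
structure CSCSpace (M : Type u) where
  X : Set M
  I : Set M
  U : Set M
  k : Set M

/-- `x ∈ U_i`. -/
def CSCSpace.InBasic (T : CSCSpace M) (x i : M) : Prop := pair x i ∈ T.U

/-- The data `T` exist in `(M, S)` and form a countable second-countable space there. -/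
structure CSCSpace.IsSpace (S : Set (Set M)) (T : CSCSpace M) : Prop where
  X_mem : T.X ∈ S
  I_mem : T.I ∈ S
  U_mem : T.U ∈ S
  k_mem : T.k ∈ S
  U_subset : T.U ⊆ cprod T.X T.I
  k_function : IsFunction T.k (cprod T.X (cprod T.I T.I)) T.I
  cover : ∀ x ∈ T.X, ∃ i ∈ T.I, T.InBasic x i
  inter : ∀ x ∈ T.X, ∀ i ∈ T.I, ∀ j ∈ T.I, T.InBasic x i → T.InBasic x j →
    ∀ l, pair (pair x (pair i j)) l ∈ T.k →
      T.InBasic x l ∧ ∀ y ∈ T.X, T.InBasic y l → T.InBasic y i ∧ T.InBasic y j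

/-- For a code `g : ℕ × ℕ → P_f(I)` of a sequence `(F_n)` of effectively closed sets,
`x ∈ F_n`, i.e. `x ∈ X` and `x ∉ U_i` for all `m` and all `i ∈ g(n, m)`. -/
def CSCSpace.InClosed (T : CSCSpace M) (g : Set M) (n x : M) : Prop :=
  x ∈ T.X ∧ ∀ m c, pair (pair n m) c ∈ g → ∀ i, FinMem i c → ¬ T.InBasic x i

/-- Every descending sequence of effectively closed sets stabilizes. -/
def CSCSpace.IsNoetherian (S : Set (Set M)) (T : CSCSpace M) : Prop :=
  ∀ g ∈ S, IsFunction g (cprod Set.univ Set.univ) (Pf T.I) →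
    (∀ n x, T.InClosed g (n + 1) x → T.InClosed g n x) →
    ∃ N, ∀ n, N < n → ∀ x, T.InClosed g n x ↔ T.InClosed g N x

/-- The upper topology of a quasi-order: the points are the elements of `Q`, the indices are the
finite subsets `i` of `Q`, with `V_i = Q \ (i↓)`, and the function is `ℓ(q, i, j) = i ∪ j`. -/
def upper (Q : RelSet M) : CSCSpace M where
  X := Q.carrier
  I := Pf Q.carrier
  U := {z | ∃ x ∈ Q.carrier, ∃ i ∈ Pf Q.carrier, z = pair x i ∧
    ¬ ∃ p, FinMem p i ∧ Q.Le x p}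
  k := {z | ∃ x ∈ Q.carrier, ∃ i ∈ Pf Q.carrier, ∃ j ∈ Pf Q.carrier, ∃ l ∈ Pf Q.carrier,
    z = pair (pair x (pair i j)) l ∧ ∀ p, FinMem p l ↔ FinMem p i ∨ FinMem p j}

/-! ### General second-countable spaces -/

/-- The data of a general second-countable space: a set `I` of codes of open sets and formulas
"`X` codes a point", "`X` and `Y` code the same point", and "the point coded by `X` is in the
open set coded by `i`". -/
structure SCSpace (M : Type u) where
  I : Set M
  IsPoint : Set M → Prop
  Same : Set M → Set M → Prop
  InBasic : Set M → M → Prop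

/-- The data `T` code a second-countable space in `(M, S)`. -/
structure SCSpace.IsSpace (S : Set (Set M)) (T : SCSpace M) : Prop where
  I_mem : T.I ∈ S
  cover : ∀ X ∈ S, T.IsPoint X → ∃ i ∈ T.I, T.InBasic X i
  inter : ∀ X ∈ S, T.IsPoint X → ∀ i ∈ T.I, ∀ j ∈ T.I, T.InBasic X i → T.InBasic X j →
    ∃ k ∈ T.I, T.InBasic X k ∧ ∀ Y ∈ S, T.InBasic Y k → T.InBasic Y i ∧ T.InBasic Y j
  congr : ∀ X ∈ S, ∀ Y ∈ S, T.IsPoint X → T.IsPoint Y → ∀ i ∈ T.I, T.InBasic X i →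
    T.Same X Y → T.InBasic Y i

/-- For a code `g : ℕ × ℕ → P_f(I)` of a sequence `(F_n)` of effectively closed sets,
`X ∈ F_n`. -/
def SCSpace.InClosed (T : SCSpace M) (g : Set M) (n : M) (X : Set M) : Prop :=
  T.IsPoint X ∧ ∀ m c, pair (pair n m) c ∈ g → ∀ i, FinMem i c → ¬ T.InBasic X i

/-- Every descending sequence of effectively closed sets stabilizes. -/
def SCSpace.IsNoetherian (S : Set (Set M)) (T : SCSpace M) : Prop :=
  ∀ g ∈ S, IsFunction g (cprod Set.univ Set.univ) (Pf T.I) →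
    (∀ n, ∀ X ∈ S, T.InClosed g (n + 1) X → T.InClosed g n X) →
    ∃ N, ∀ n, N < n → ∀ X ∈ S, T.InClosed g n X ↔ T.InClosed g N X

/-- The second-countable space `upper(P^♭(Q))`: the points are the subsets of `Q`, and `X` is in
the open set coded by the finite set `i` if `i ⊆ X↓`. -/
def upperPFlat (Q : RelSet M) : SCSpace M where
  I := Pf Q.carrier
  IsPoint X := X ⊆ Q.carrier
  Same X Y := X = Y
  InBasic X i := ∀ q, FinMem q i → ∃ p ∈ X, Q.Le q p

/-- The second-countable space `upper(P^♯(Q))`: the points are the subsets of `Q`, and `X` is in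
the open set coded by the finite set `i` if `i ∩ X↑ = ∅`. -/
def upperPSharp (Q : RelSet M) : SCSpace M where
  I := Pf Q.carrier
  IsPoint X := X ⊆ Q.carrier
  Same X Y := X = Y
  InBasic X i := ∀ q, FinMem q i → ¬ ∃ p ∈ X, Q.Le p q

end Spaces

end SOA

/-! Sending the code of a finite set to that set embeds `upper(P_f^♭(Q))` into `upper(P^♭(Q))`, and
likewise for `♯`. Each basic open set `U_i` of the countable space is the preimage of the union of
certain basic open sets `j` of the large one: in the case of `♭`, `j` runs through the points of
`U_i`, and in the case of `♯`, through the finite sets that meet every member of `i`. The relation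
between `i` and `j` is bounded, so a descending sequence of effectively closed sets is the preimage
of such a sequence in the large space, and stabilizes with it. -/

namespace SOA

open Matrix (vecCons vecTail)

section Definability

variable {M : Type*} [CommSemiring M] {S : Set (Set M)} {n m : ℕ}

/-- The functions given by number terms with number parameters. -/
inductive IsTerm : ((Fin n → M) → M) → Prop
  | var (i : Fin n) : IsTerm fun v => v i
  | const (c : M) : IsTerm fun _ => c
  | add {f g : (Fin n → M) → M} : IsTerm f → IsTerm g → IsTerm fun v => f v + g v
  | mul {f g : (Fin n → M) → M} : IsTerm f → IsTerm g → IsTerm fun v => f v * g v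

/-- The functions given by number terms with parameters from `F`. So that terms can be combined,
the variables and the parameters may be placed anywhere among `m` variables, by `ρ` and `γ`. -/
def IsTermOver (F : Set M) (f : (Fin n → M) → M) : Prop :=
  ∀ (m : ℕ) (ρ : Fin n → Fin m) (γ : M → Fin m), ∃ t : NumTerm m,
    ∀ w, Set.EqOn (w ∘ γ) id F → t.eval w = f (w ∘ ρ)

namespace IsTermOver

variable {F G : Set M} {f g : (Fin n → M) → M}

theorem mono (hf : IsTermOver F f) (h : F ⊆ G) : IsTermOver G f := fun m ρ γ =>
  let ⟨t, ht⟩ := hf m ρ γ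
  ⟨t, fun w hw => ht w (hw.mono h)⟩

theorem add (hf : IsTermOver F f) (hg : IsTermOver F g) : IsTermOver F fun v => f v + g v :=
  fun m ρ γ =>
    let ⟨s, hs⟩ := hf m ρ γ
    let ⟨t, ht⟩ := hg m ρ γ
    ⟨.add s t, fun w hw => congr_arg₂ (· + ·) (hs w hw) (ht w hw)⟩

theorem mul (hf : IsTermOver F f) (hg : IsTermOver F g) : IsTermOver F fun v => f v * g v :=
  fun m ρ γ =>
    let ⟨s, hs⟩ := hf m ρ γ
    let ⟨t, ht⟩ := hg m ρ γ
    ⟨.mul s t, fun w hw => congr_arg₂ (· * ·) (hs w hw) (ht w hw)⟩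

end IsTermOver

namespace IsTerm

variable {f g : (Fin n → M) → M}

theorem pair (hf : IsTerm f) (hg : IsTerm g) : IsTerm fun v => SOA.pair (f v) (g v) :=
  ((hf.add hg).mul (hf.add hg)).add hf

theorem comp (hf : IsTerm f) {t : Fin n → (Fin m → M) → M} (ht : ∀ i, IsTerm (t i)) :
    IsTerm fun v => f fun i => t i v := by
  induction hf with
  | var i => exact ht i
  | const c => exact .const c
  | add _ _ ihf ihg => exact ihf.add ihg
  | mul _ _ ihf ihg => exact ihf.mul ihg

theorem vecTail (hf : IsTerm f) : IsTerm fun v => f (vecTail v) :=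
  hf.comp fun i => .var i.succ

theorem exists_isTermOver (hf : IsTerm f) : ∃ F : Set M, F.Finite ∧ IsTermOver F f := by
  induction hf with
  | var i => exact ⟨∅, Set.finite_empty, fun _ ρ _ => ⟨.var (ρ i), fun _ _ => rfl⟩⟩
  | const c => exact ⟨{c}, Set.finite_singleton c, fun _ _ γ => ⟨.var (γ c), fun _ h => h rfl⟩⟩
  | add _ _ ihf ihg =>
    obtain ⟨F, hF, hf⟩ := ihf
    obtain ⟨G, hG, hg⟩ := ihg
    exact ⟨F ∪ G, hF.union hG,
      (hf.mono Set.subset_union_left).add (hg.mono Set.subset_union_right)⟩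
  | mul _ _ ihf ihg =>
    obtain ⟨F, hF, hf⟩ := ihf
    obtain ⟨G, hG, hg⟩ := ihg
    exact ⟨F ∪ G, hF.union hG,
      (hf.mono Set.subset_union_left).mul (hg.mono Set.subset_union_right)⟩

end IsTerm

variable [LinearOrder M]

/-- The predicates given by bounded formulas with number parameters and with set parameters from
`S`. As in `BddFormula.ball`, the variable bound last is the variable `0`. -/
inductive IsDelta0 (S : Set (Set M)) : {n : ℕ} → ((Fin n → M) → Prop) → Prop
  | eq {n : ℕ} {f g : (Fin n → M) → M} : IsTerm f → IsTerm g → IsDelta0 S fun v => f v = g v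
  | lt {n : ℕ} {f g : (Fin n → M) → M} : IsTerm f → IsTerm g → IsDelta0 S fun v => f v < g v
  | mem {n : ℕ} {A : Set M} {f : (Fin n → M) → M} :
      A ∈ S → IsTerm f → IsDelta0 S fun v => f v ∈ A
  | not {n : ℕ} {P : (Fin n → M) → Prop} : IsDelta0 S P → IsDelta0 S fun v => ¬ P v
  | and {n : ℕ} {P R : (Fin n → M) → Prop} :
      IsDelta0 S P → IsDelta0 S R → IsDelta0 S fun v => P v ∧ R v
  | forall_lt {n : ℕ} {f : (Fin n → M) → M} {P : (Fin n → M) → M → Prop} :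
      IsTerm f → IsDelta0 S (fun w : Fin (n + 1) → M => P (vecTail w) (w 0)) →
      IsDelta0 S fun v => ∀ a < f v, P v a

/-- The predicates given by bounded formulas with number parameters from `F` and set parameters
from `𝓐`, which may be placed anywhere by `γ` and `σ`. -/
def IsDelta0Over (F : Set M) (𝓐 : Set (Set M)) (P : (Fin n → M) → Prop) : Prop :=
  ∀ (m : ℕ) (ρ : Fin n → Fin m) (γ : M → Fin m) (σ : Set M → ℕ), ∃ φ : BddFormula m,
    ∀ E w, Set.EqOn (E ∘ σ) id 𝓐 → Set.EqOn (w ∘ γ) id F → (φ.Holds E w ↔ P (w ∘ ρ))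

namespace IsDelta0Over

variable {F G : Set M} {𝓐 𝓑 : Set (Set M)} {f g : (Fin n → M) → M} {P R : (Fin n → M) → Prop}

theorem mono (hP : IsDelta0Over F 𝓐 P) (h : F ⊆ G) (h' : 𝓐 ⊆ 𝓑) : IsDelta0Over G 𝓑 P :=
  fun m ρ γ σ =>
    let ⟨φ, hφ⟩ := hP m ρ γ σ
    ⟨φ, fun E w hE hw => hφ E w (hE.mono h') (hw.mono h)⟩

theorem eq (hf : IsTermOver F f) (hg : IsTermOver F g) :
    IsDelta0Over F 𝓐 fun v => f v = g v := fun m ρ γ _ =>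
  let ⟨s, hs⟩ := hf m ρ γ
  let ⟨t, ht⟩ := hg m ρ γ
  ⟨.eq s t, fun _ w _ hw => by rw [BddFormula.Holds, hs w hw, ht w hw]⟩

theorem lt (hf : IsTermOver F f) (hg : IsTermOver F g) :
    IsDelta0Over F 𝓐 fun v => f v < g v := fun m ρ γ _ =>
  let ⟨s, hs⟩ := hf m ρ γ
  let ⟨t, ht⟩ := hg m ρ γ
  ⟨.lt s t, fun _ w _ hw => by rw [BddFormula.Holds, hs w hw, ht w hw]⟩

theorem mem (A : Set M) (hf : IsTermOver F f) : IsDelta0Over F {A} fun v => f v ∈ A :=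
  fun m ρ γ σ =>
    let ⟨t, ht⟩ := hf m ρ γ
    ⟨.mem t (σ A), fun E w hE hw => by rw [BddFormula.Holds, ht w hw, show E (σ A) = A from hE rfl]⟩

theorem not (hP : IsDelta0Over F 𝓐 P) : IsDelta0Over F 𝓐 fun v => ¬ P v := fun m ρ γ σ =>
  let ⟨φ, hφ⟩ := hP m ρ γ σ
  ⟨.neg φ, fun E w hE hw => not_congr (hφ E w hE hw)⟩

theorem and (hP : IsDelta0Over F 𝓐 P) (hR : IsDelta0Over F 𝓐 R) :
    IsDelta0Over F 𝓐 fun v => P v ∧ R v := fun m ρ γ σ =>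
  let ⟨φ, hφ⟩ := hP m ρ γ σ
  let ⟨ψ, hψ⟩ := hR m ρ γ σ
  ⟨.and φ ψ, fun E w hE hw => and_congr (hφ E w hE hw) (hψ E w hE hw)⟩

theorem forall_lt {P : (Fin n → M) → M → Prop} (hf : IsTermOver F f)
    (hP : IsDelta0Over F 𝓐 fun w : Fin (n + 1) → M => P (vecTail w) (w 0)) :
    IsDelta0Over F 𝓐 fun v => ∀ a < f v, P v a := fun m ρ γ σ =>
  let ⟨t, ht⟩ := hf m ρ γ
  let ⟨φ, hφ⟩ := hP (m + 1) (Fin.cases 0 fun i => (ρ i).succ) (fun c => (γ c).succ) σ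
  ⟨.ball t φ, fun E w hE hw => by
    rw [BddFormula.Holds, ht w hw]
    exact forall₂_congr fun a _ => hφ E (vecCons a w) hE hw⟩

end IsDelta0Over

namespace IsDelta0

section Connectives

variable {P R : (Fin n → M) → Prop}

theorem congr (hP : IsDelta0 S P) (h : ∀ v, P v ↔ R v) : IsDelta0 S R := by
  obtain rfl : P = R := funext fun v => propext (h v)
  exact hP

theorem or (hP : IsDelta0 S P) (hR : IsDelta0 S R) : IsDelta0 S fun v => P v ∨ R v :=
  (hP.not.and hR.not).not.congr fun v => by tauto

theorem imp (hP : IsDelta0 S P) (hR : IsDelta0 S R) : IsDelta0 S fun v => P v → R v :=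
  (hP.not.or hR).congr fun v => by tauto

theorem iff (hP : IsDelta0 S P) (hR : IsDelta0 S R) : IsDelta0 S fun v => P v ↔ R v :=
  ((hP.imp hR).and (hR.imp hP)).congr fun v => by tauto

end Connectives

section Quantifiers

variable {f : (Fin n → M) → M} {P : (Fin n → M) → M → Prop}

theorem exists_lt (hf : IsTerm f)
    (hP : IsDelta0 S fun w : Fin (n + 1) → M => P (vecTail w) (w 0)) :
    IsDelta0 S fun v => ∃ a < f v, P v a :=
  (forall_lt (P := fun v a => ¬ P v a) hf hP.not).not.congr fun v => by push Not; rfl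

theorem exists_of_lt (hf : IsTerm f) (hlt : ∀ v a, P v a → a < f v)
    (hP : IsDelta0 S fun w : Fin (n + 1) → M => P (vecTail w) (w 0)) :
    IsDelta0 S fun v => ∃ a, P v a :=
  (exists_lt hf hP).congr fun v => exists_congr fun a => and_iff_right_of_imp (hlt v a)

theorem forall_of_lt (hf : IsTerm f) (hlt : ∀ v a, ¬ P v a → a < f v)
    (hP : IsDelta0 S fun w : Fin (n + 1) → M => P (vecTail w) (w 0)) :
    IsDelta0 S fun v => ∀ a, P v a :=
  (exists_of_lt (P := fun v a => ¬ P v a) hf hlt hP.not).not.congr fun v => by push Not; rfl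

end Quantifiers

theorem comp {P : (Fin n → M) → Prop} (hP : IsDelta0 S P) {t : Fin n → (Fin m → M) → M}
    (ht : ∀ i, IsTerm (t i)) : IsDelta0 S fun v => P fun i => t i v := by
  induction hP generalizing m with
  | eq hf hg => exact .eq (hf.comp ht) (hg.comp ht)
  | lt hf hg => exact .lt (hf.comp ht) (hg.comp ht)
  | mem hA hf => exact .mem hA (hf.comp ht)
  | not _ ih => exact (ih ht).not
  | and _ _ ihP ihR => exact (ihP ht).and (ihR ht)
  | forall_lt hf _ ih =>
    exact .forall_lt (hf.comp ht) (ih (t := Fin.cases (fun w => w 0) fun i w => t i (vecTail w))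
      (Fin.cases (.var 0) fun i => (ht i).vecTail))

theorem exists_isDelta0Over {P : (Fin n → M) → Prop} (hP : IsDelta0 S P) :
    ∃ (F : Set M) (𝓐 : Set (Set M)), F.Finite ∧ 𝓐.Finite ∧ 𝓐 ⊆ S ∧ IsDelta0Over F 𝓐 P := by
  induction hP with
  | eq hf hg =>
    obtain ⟨F, hF, hf⟩ := hf.exists_isTermOver
    obtain ⟨G, hG, hg⟩ := hg.exists_isTermOver
    exact ⟨F ∪ G, ∅, hF.union hG, Set.finite_empty, Set.empty_subset S,
      .eq (hf.mono Set.subset_union_left) (hg.mono Set.subset_union_right)⟩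
  | lt hf hg =>
    obtain ⟨F, hF, hf⟩ := hf.exists_isTermOver
    obtain ⟨G, hG, hg⟩ := hg.exists_isTermOver
    exact ⟨F ∪ G, ∅, hF.union hG, Set.finite_empty, Set.empty_subset S,
      .lt (hf.mono Set.subset_union_left) (hg.mono Set.subset_union_right)⟩
  | @mem _ A _ hA hf =>
    obtain ⟨F, hF, hf⟩ := hf.exists_isTermOver
    exact ⟨F, {A}, hF, Set.finite_singleton A, Set.singleton_subset_iff.2 hA, .mem A hf⟩
  | not _ ih =>
    obtain ⟨F, 𝓐, hF, h𝓐, hS, hP⟩ := ih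
    exact ⟨F, 𝓐, hF, h𝓐, hS, hP.not⟩
  | and _ _ ihP ihR =>
    obtain ⟨F, 𝓐, hF, h𝓐, hS, hP⟩ := ihP
    obtain ⟨G, 𝓑, hG, h𝓑, hS', hR⟩ := ihR
    exact ⟨F ∪ G, 𝓐 ∪ 𝓑, hF.union hG, h𝓐.union h𝓑, Set.union_subset hS hS',
      (hP.mono Set.subset_union_left Set.subset_union_left).and
        (hR.mono Set.subset_union_right Set.subset_union_right)⟩
  | forall_lt hf _ ih =>
    obtain ⟨F, hF, hf⟩ := hf.exists_isTermOver
    obtain ⟨G, 𝓐, hG, h𝓐, hS, hP⟩ := ih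
    exact ⟨F ∪ G, 𝓐, hF.union hG, h𝓐, hS,
      .forall_lt (hf.mono Set.subset_union_left) (hP.mono Set.subset_union_right subset_rfl)⟩

theorem exists_holds_iff [Nonempty S] {P : M → M → Prop}
    (hP : IsDelta0 S fun v : Fin 2 → M => P (v 1) (v 0)) :
    ∃ (k : ℕ) (θ : BddFormula (k + 2)) (E : ℕ → Set M) (e : Fin k → M), (∀ i, E i ∈ S) ∧
      ∀ x y, θ.Holds E (vecCons y (vecCons x e)) ↔ P x y := by
  obtain ⟨F, 𝓐, hF, h𝓐, hS, hP⟩ := hP.exists_isDelta0Over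
  obtain ⟨k, e, -, rfl⟩ := hF.fin_param
  obtain ⟨A₀, hA₀⟩ := ‹Nonempty S›
  obtain ⟨E, hE⟩ := (h𝓐.countable.insert A₀).exists_eq_range (Set.insert_nonempty A₀ 𝓐)
  have parameter_index (c : M) : ∃ i : Fin (k + 2), c ∈ Set.range e →
      ∀ x y, vecCons y (vecCons x e) i = c := by
    by_cases hc : c ∈ Set.range e
    · obtain ⟨i, rfl⟩ := hc
      exact ⟨i.succ.succ, fun _ _ _ => rfl⟩
    · exact ⟨0, fun h => absurd h hc⟩
  choose γ hγ using parameter_index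
  obtain ⟨θ, hθ⟩ := hP (k + 2) ![0, 1] γ (Function.invFun E)
  refine ⟨k, θ, E, e, fun i => ?_, fun x y => hθ E _ (fun A hA => ?_) fun c hc => hγ c hc x y⟩
  · exact Set.insert_subset hA₀ hS (hE ▸ Set.mem_range_self i)
  · exact Function.invFun_eq (hE ▸ Set.mem_insert_of_mem A₀ hA : A ∈ Set.range E)

end IsDelta0

/-- The predicates given by `Σ⁰₁` formulas with number parameters and with set parameters from
`S`. -/
def IsSigma1 (S : Set (Set M)) (P : (Fin n → M) → Prop) : Prop :=
  ∃ R : (Fin n → M) → M → Prop,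
    IsDelta0 S (fun w : Fin (n + 1) → M => R (vecTail w) (w 0)) ∧ ∀ v, P v ↔ ∃ y, R v y

theorem IsDelta0.isSigma1 {P : (Fin n → M) → Prop} (hP : IsDelta0 S P) : IsSigma1 S P :=
  ⟨fun v _ => P v, hP.comp fun i => .var i.succ, fun _ => (exists_const M).symm⟩

theorem IsSigma1.exists [IsStrictOrderedRing M] {P : (Fin n → M) → M → Prop} (hM : ModelsRCA0 S)
    (hP : IsSigma1 S fun w : Fin (n + 1) → M => P (vecTail w) (w 0)) :
    IsSigma1 S fun v => ∃ a, P v a := by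
  obtain ⟨R, hR, hPR⟩ := hP
  refine ⟨fun v z => ∃ a < z, ∃ y < z, R (vecCons a v) y, ?_, fun v => ⟨?_, ?_⟩⟩
  · exact .exists_lt (.var 0) (.exists_lt (.var 1) (hR.comp
      (t := fun i u => vecCons (u 0) (vecCons (u 1) (vecTail (vecTail (vecTail u)))) i)
      (Fin.cases (.var 0) (Fin.cases (.var 1) fun i => .var i.succ.succ.succ))))
  · rintro ⟨a, ha⟩
    obtain ⟨y, hy⟩ := (hPR (vecCons a v)).1 ha
    exact ⟨max a y + 1, a, (hM.discrete _ _).2 (le_max_left a y), y,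
      (hM.discrete _ _).2 (le_max_right a y), hy⟩
  · rintro ⟨z, a, -, y, -, hy⟩
    exact ⟨a, (hPR (vecCons a v)).2 ⟨y, hy⟩⟩

theorem IsSigma1.and [IsStrictOrderedRing M] {P Q : (Fin n → M) → Prop} (hM : ModelsRCA0 S)
    (hP : IsSigma1 S P) (hQ : IsSigma1 S Q) : IsSigma1 S fun v => P v ∧ Q v := by
  obtain ⟨R, hR, hPR⟩ := hP
  obtain ⟨T, hT, hQT⟩ := hQ
  have isSigma1_prenex : IsSigma1 S fun v => ∃ y z, R v y ∧ T v z :=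
    .exists hM (.exists hM (IsDelta0.isSigma1 ((hR.comp fun i => .var i.succ).and
      (hT.comp (t := fun i u => vecCons (u 0) (vecTail (vecTail u)) i)
        (Fin.cases (.var 0) fun i => .var i.succ.succ)))))
  simpa only [exists_and_left, exists_and_right, ← hPR, ← hQT] using isSigma1_prenex

end Definability

section Models

variable {M : Type*} [CommSemiring M] [LinearOrder M] [IsStrictOrderedRing M] {S : Set (Set M)}

namespace ModelsRCA0

variable (hM : ModelsRCA0 S)
include hM

section Schemes

variable [Nonempty S] {P : M → Prop}

theorem comprehension (hP : IsDelta0 S fun v : Fin 1 → M => P (v 0)) : {x | P x} ∈ S := by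
  obtain ⟨k, θ, E, e, hE, hθ⟩ :=
    IsDelta0.exists_holds_iff (P := fun x _ => P x) (hP.comp fun _ => .var 1)
  simpa only [hθ, exists_const] using
    hM.delta_comprehension k θ θ E e hE fun x => by simp only [hθ, exists_const, forall_const]

theorem sigma1_induction (hP : IsSigma1 S fun v : Fin 1 → M => P (v 0)) (zero : P 0)
    (succ : ∀ x, P x → P (x + 1)) (x : M) : P x := by
  obtain ⟨R, hR, hPR⟩ := hP
  obtain ⟨k, θ, E, e, hE, hθ⟩ := IsDelta0.exists_holds_iff (P := fun x => R ![x]) <|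
    hR.congr fun v => by rw [show vecTail v = ![v 1] from funext fun i => by fin_cases i; rfl]
  have holds_iff (x : M) : (∃ y, θ.Holds E (vecCons y (vecCons x e))) ↔ P x := by
    simp only [hθ]
    exact (hPR ![x]).symm
  have h := hM.sigma_induction k θ E e hE
  simp only [holds_iff] at h
  exact h zero succ x

end Schemes

end ModelsRCA0

end Models

section Arithmetic

variable {M : Type*} [CommSemiring M] [LinearOrder M] [IsStrictOrderedRing M] {S : Set (Set M)}

namespace ModelsRCA0

variable (hM : ModelsRCA0 S)
include hM

theorem add_one_le_iff {x y : M} : x + 1 ≤ y ↔ x < y := by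
  rw [← not_lt, hM.discrete, not_le]

theorem not_lt_zero (x : M) : ¬ x < 0 := (hM.zero_le x).not_gt

theorem pos_iff_ne_zero {x : M} : 0 < x ↔ x ≠ 0 :=
  ⟨ne_of_gt, fun h => (hM.zero_le x).lt_of_ne h.symm⟩

theorem add_one_ne_zero (x : M) : x + 1 ≠ 0 :=
  hM.pos_iff_ne_zero.1 ((hM.discrete 0 x).2 (hM.zero_le x))

theorem le_add_right (x y : M) : x ≤ x + y := le_add_of_nonneg_right (hM.zero_le y)

theorem le_add_left (x y : M) : y ≤ x + y := le_add_of_nonneg_left (hM.zero_le x)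

theorem le_mul_right (x : M) {y : M} (h : y ≠ 0) : x ≤ x * y :=
  le_mul_of_one_le_right (hM.zero_le x) <| by
    simpa only [zero_add] using hM.add_one_le_iff.2 (hM.pos_iff_ne_zero.2 h)

theorem le_of_dvd {a b : M} (hb : b ≠ 0) (h : a ∣ b) : a ≤ b := by
  obtain ⟨c, rfl⟩ := h
  exact hM.le_mul_right _ (right_ne_zero_of_mul hb)

theorem add_le_pair (x y : M) : x + y ≤ pair x y := by
  refine le_trans ?_ (hM.le_add_right _ _)
  obtain h | h := eq_or_ne (x + y) 0
  · rw [h, zero_mul]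
  · exact hM.le_mul_right _ h

theorem lt_pair_add_one_left (x y : M) : x < pair x y + 1 :=
  (hM.discrete _ _).2 ((hM.le_add_right x y).trans (hM.add_le_pair x y))

theorem lt_pair_add_one_right (x y : M) : y < pair x y + 1 :=
  (hM.discrete _ _).2 ((hM.le_add_left x y).trans (hM.add_le_pair x y))

/-- The pairs with sum `s` have codes between `s ^ 2` and `s ^ 2 + s`, hence below
`(s + 1) ^ 2`. -/
theorem pair_lt_pair {x y x' y' : M} (h : x + y < x' + y') : pair x y < pair x' y' := by
  calc pair x y ≤ (x + y) * (x + y) + (x + y) := by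
        unfold pair
        gcongr
        exact hM.le_add_right x y
    _ < (x + y) * (x + y) + (x + y) + (x + y + 1) :=
        lt_add_of_pos_right _ (hM.pos_iff_ne_zero.2 (hM.add_one_ne_zero _))
    _ = (x + y + 1) * (x + y + 1) := by ring
    _ ≤ (x' + y') * (x' + y') := mul_self_le_mul_self (hM.zero_le _) (hM.add_one_le_iff.2 h)
    _ ≤ pair x' y' := hM.le_add_right _ _

theorem pair_inj {x y x' y' : M} : pair x y = pair x' y' ↔ x = x' ∧ y = y' := by
  refine ⟨fun h => ?_, fun ⟨hx, hy⟩ => hx ▸ hy ▸ rfl⟩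
  have hs : x + y = x' + y' := by
    rcases lt_trichotomy (x + y) (x' + y') with hlt | heq | hlt
    · exact absurd h (hM.pair_lt_pair hlt).ne
    · exact heq
    · exact absurd h (hM.pair_lt_pair hlt).ne'
  have hx : x = x' := by
    unfold pair at h
    rw [hs] at h
    exact add_left_cancel h
  exact ⟨hx, add_left_cancel (hx ▸ hs)⟩

theorem pair_mem_cprod {A B : Set M} {x y : M} : pair x y ∈ cprod A B ↔ x ∈ A ∧ y ∈ B := by
  constructor
  · rintro ⟨a, ha, b, hb, h⟩
    obtain ⟨rfl, rfl⟩ := hM.pair_inj.1 h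
    exact ⟨ha, hb⟩
  · rintro ⟨hx, hy⟩
    exact ⟨x, hx, y, hy, rfl⟩

section Induction

variable [Nonempty S]

theorem exists_least {P : M → Prop} (hP : IsDelta0 S fun v : Fin 1 → M => P (v 0)) {x : M}
    (hx : P x) : ∃ y, P y ∧ ∀ z < y, ¬ P z := by
  by_contra! h
  have no_instance_below (y : M) : ∀ z < y, ¬ P z := by
    refine hM.sigma1_induction (P := fun y => ∀ z < y, ¬ P z)
      (IsDelta0.forall_lt (.var 0) (hP.comp fun _ => .var 0).not).isSigma1
      (fun z hz => absurd hz (hM.not_lt_zero z)) (fun y hy z hz hPz => ?_) y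
    obtain ⟨w, hwz, hw⟩ := h z hPz
    exact hy w (hwz.trans_le ((hM.discrete z y).1 hz)) hw
  exact no_instance_below (x + 1) x (lt_add_one x) hx

theorem exists_eq_add_of_le {x y : M} (h : x ≤ y) : ∃ z, y = x + z := by
  suffices ∃ z, y = x + z ∨ y < x by
    obtain ⟨z, hz | hz⟩ := this
    · exact ⟨z, hz⟩
    · exact absurd hz h.not_gt
  refine hM.sigma1_induction (P := fun y => ∃ z, y = x + z ∨ y < x)
    (IsSigma1.exists hM (IsDelta0.isSigma1 ((IsDelta0.eq (.var 1) (.add (.const x) (.var 0))).or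
      (.lt (.var 1) (.const x))))) ⟨0, ?_⟩ ?_ y
  · rw [add_zero]
    exact (hM.zero_le x).eq_or_lt
  · rintro y ⟨z, rfl | hy⟩
    · exact ⟨z + 1, .inl (add_assoc x z 1)⟩
    · refine ⟨0, ?_⟩
      rw [add_zero]
      exact (hM.add_one_le_iff.2 hy).eq_or_lt

theorem dvd_of_dvd_add {p a b : M} (hp : p ≠ 0) (ha : p ∣ a) (hab : p ∣ a + b) : p ∣ b := by
  obtain ⟨u, rfl⟩ := ha
  obtain ⟨w, hw⟩ := hab
  have huw : u ≤ w :=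
    le_of_mul_le_mul_left (hw ▸ hM.le_add_right (p * u) b) (hM.pos_iff_ne_zero.2 hp)
  obtain ⟨z, rfl⟩ := hM.exists_eq_add_of_le huw
  rw [mul_add] at hw
  exact ⟨z, add_left_cancel hw⟩

end Induction

theorem finMem_pair {i k m n : M} :
    FinMem i (pair k (pair m n)) ↔ i < k ∧ m * (i + 1) + 1 ∣ n := by
  constructor
  · rintro ⟨k', m', n', h, hi⟩
    obtain ⟨rfl, h'⟩ := hM.pair_inj.1 h
    obtain ⟨rfl, rfl⟩ := hM.pair_inj.1 h'
    exact hi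
  · exact fun h => ⟨k, m, n, rfl, h⟩

theorem lt_of_finMem {i c : M} (h : FinMem i c) : i < c := by
  obtain ⟨k, m, n, rfl, hi, -⟩ := h
  exact hi.trans_le ((hM.discrete _ _).1 (hM.lt_pair_add_one_left k _))

theorem not_finMem_zero (i : M) : ¬ FinMem i 0 := fun h => hM.not_lt_zero i (hM.lt_of_finMem h)

theorem zero_mem_Pf (A : Set M) : (0 : M) ∈ Pf A :=
  ⟨fun d hd => absurd hd (hM.not_lt_zero d), fun i hi => absurd hi (hM.not_finMem_zero i)⟩

end ModelsRCA0

namespace IsDelta0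

variable {n : ℕ} {f g : (Fin n → M) → M} (hM : ModelsRCA0 S)
include hM

theorem dvd (hf : IsTerm f) (hg : IsTerm g) : IsDelta0 S fun v => f v ∣ g v := by
  refine (exists_lt (P := fun v q => g v = f v * q) (hg.add (.const 1))
    (.eq hg.vecTail (.mul hf.vecTail (.var 0)))).congr fun v => ⟨fun ⟨q, _, h⟩ => ⟨q, h⟩, ?_⟩
  rintro ⟨q, h⟩
  obtain h0 | h0 := eq_or_ne (g v) 0
  · exact ⟨0, (hM.discrete _ _).2 (hM.zero_le _), by rw [h0, mul_zero]⟩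
  · exact ⟨q, (hM.discrete _ _).2 (hM.le_of_dvd h0 (h ▸ dvd_mul_left q (f v))), h⟩

theorem exists_eq_pair {P : (Fin n → M) → M → M → Prop} (hf : IsTerm f)
    (hP : IsDelta0 S fun w : Fin (n + 2) → M => P (vecTail (vecTail w)) (w 1) (w 0)) :
    IsDelta0 S fun v => ∃ a b, f v = pair a b ∧ P v a b :=
  .exists_of_lt (hf.add (.const 1))
    (fun _ a ⟨b, h, _⟩ => h ▸ hM.lt_pair_add_one_left a b)
    (.exists_of_lt (hf.vecTail.add (.const 1))
      (fun w b ⟨h, _⟩ => h ▸ hM.lt_pair_add_one_right (w 0) b)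
      (.and (.eq hf.vecTail.vecTail (.pair (.var 1) (.var 0))) hP))

theorem finMem (hf : IsTerm f) (hg : IsTerm g) : IsDelta0 S fun v => FinMem (f v) (g v) := by
  refine (exists_eq_pair hM (P := fun v k c => ∃ m n, c = pair m n ∧
      (f v < k ∧ m * (f v + 1) + 1 ∣ n)) hg
    (exists_eq_pair hM (.var 0) (.and (.lt hf.vecTail.vecTail.vecTail.vecTail (.var 3))
      (dvd hM (((IsTerm.var 1).mul
        (hf.vecTail.vecTail.vecTail.vecTail.add (.const 1))).add (.const 1)) (.var 0))))).congr
    fun v => ⟨?_, ?_⟩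
  · rintro ⟨k, _, h, m, n, rfl, h'⟩
    exact ⟨k, m, n, h, h'⟩
  · rintro ⟨k, m, n, h, h'⟩
    exact ⟨k, _, h, m, n, rfl, h'⟩

theorem exists_finMem {P : (Fin n → M) → M → Prop} (hf : IsTerm f)
    (hP : IsDelta0 S fun w : Fin (n + 1) → M => P (vecTail w) (w 0)) :
    IsDelta0 S fun v => ∃ a, FinMem a (f v) ∧ P v a :=
  .exists_of_lt hf (fun _ _ h => hM.lt_of_finMem h.1) (.and (finMem hM (.var 0) hf.vecTail) hP)

theorem forall_finMem {P : (Fin n → M) → M → Prop} (hf : IsTerm f)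
    (hP : IsDelta0 S fun w : Fin (n + 1) → M => P (vecTail w) (w 0)) :
    IsDelta0 S fun v => ∀ a, FinMem a (f v) → P v a :=
  (exists_finMem hM (P := fun v a => ¬ P v a) hf hP.not).not.congr fun v => by push Not; rfl

theorem forall_finMem_iff {P : (Fin n → M) → M → Prop} (hf : IsTerm f) (hg : IsTerm g)
    (hlt : ∀ v a, P v a → a < g v)
    (hP : IsDelta0 S fun w : Fin (n + 1) → M => P (vecTail w) (w 0)) :
    IsDelta0 S fun v => ∀ a, FinMem a (f v) ↔ P v a := by
  refine .forall_of_lt (hf.add hg) (fun v a h => ?_) (.iff (finMem hM (.var 0) hf.vecTail) hP)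
  by_contra! ha
  exact h (iff_of_false
    (fun haf => ((hM.le_add_right _ _).trans ha).not_gt (hM.lt_of_finMem haf))
    fun haP => ((hM.le_add_left _ _).trans ha).not_gt (hlt v a haP))

theorem isFinCode (hf : IsTerm f) : IsDelta0 S fun v => IsFinCode (f v) :=
  .forall_lt hf ((forall_finMem_iff hM (.var 0) hf.vecTail (fun _ _ => hM.lt_of_finMem)
    (finMem hM (.var 0) hf.vecTail.vecTail)).not.congr fun _ => not_forall)

theorem mem_Pf {A : Set M} (hA : A ∈ S) (hf : IsTerm f) : IsDelta0 S fun v => f v ∈ Pf A :=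
  (isFinCode hM hf).and (forall_finMem hM hf (.mem hA (.var 0)))

end IsDelta0

end Arithmetic

section Coding

variable {M : Type*} [CommSemiring M] [LinearOrder M] [IsStrictOrderedRing M] {S : Set (Set M)}

omit [IsStrictOrderedRing M] in
theorem IsFinCode.ext {c d : M} (hc : IsFinCode c) (hd : IsFinCode d)
    (h : ∀ i, FinMem i c ↔ FinMem i d) : c = d := by
  rcases lt_trichotomy c d with hlt | heq | hlt
  · obtain ⟨i, hi⟩ := hd c hlt
    exact absurd (h i) hi
  · exact heq
  · obtain ⟨i, hi⟩ := hc d hlt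
    exact absurd (h i).symm hi

namespace ModelsRCA0

variable (hM : ModelsRCA0 S)
include hM

theorem exists_difference [Nonempty S] {x y : M} (h : x ≠ y) :
    ∃ d < max x y, x + 1 = y + 1 + (d + 1) ∨ y + 1 = x + 1 + (d + 1) := by
  rcases h.lt_or_gt with h | h
  · obtain ⟨d, rfl⟩ := hM.exists_eq_add_of_le (hM.add_one_le_iff.2 h)
    refine ⟨d, lt_max_of_lt_right ?_, .inr (add_assoc _ _ _)⟩
    exact lt_add_of_pos_left d (hM.pos_iff_ne_zero.2 (hM.add_one_ne_zero x))
  · obtain ⟨d, rfl⟩ := hM.exists_eq_add_of_le (hM.add_one_le_iff.2 h)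
    refine ⟨d, lt_max_of_lt_left ?_, .inl (add_assoc _ _ _)⟩
    exact lt_add_of_pos_left d (hM.pos_iff_ne_zero.2 (hM.add_one_ne_zero y))

theorem exists_common_multiple [Nonempty S] (b : M) :
    ∃ m, m ≠ 0 ∧ ∀ d < b, d + 1 ∣ m := by
  refine hM.sigma1_induction (P := fun b => ∃ m, m ≠ 0 ∧ ∀ d < b, d + 1 ∣ m)
    (IsSigma1.exists hM (IsDelta0.isSigma1 ((IsDelta0.eq (.var 0) (.const 0)).not.and
      (.forall_lt (.var 1) (.dvd hM (.add (.var 0) (.const 1)) (.var 1))))))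
    ⟨1, one_ne_zero, fun d hd => absurd hd (hM.not_lt_zero d)⟩ ?_ b
  rintro b ⟨m, hm0, hm⟩
  have hmb := mul_pos (hM.pos_iff_ne_zero.2 hm0) (hM.pos_iff_ne_zero.2 (hM.add_one_ne_zero b))
  refine ⟨m * (b + 1), hmb.ne', fun d hd => ?_⟩
  obtain hd | rfl := ((hM.discrete d b).1 hd).lt_or_eq
  · exact (hm d hd).mul_right _
  · exact dvd_mul_left _ m

/-- Gödel's moduli `m * u + 1` and `m * v + 1` are coprime because any common divisor divides
`d = |u - v|`, hence `m`. -/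
theorem dvd_of_dvd_mul_modulus [Nonempty S] {m u v d n : M} (hd : d ∣ m)
    (huv : u = v + d ∨ v = u + d) (h : m * u + 1 ∣ n * (m * v + 1)) : m * u + 1 ∣ n := by
  have hp : m * u + 1 ≠ 0 := hM.add_one_ne_zero _
  have dvd_mul_diff : m * u + 1 ∣ n * d := by
    rcases huv with rfl | rfl
    · refine hM.dvd_of_dvd_add (a := n * v * (m * (v + d) + 1)) hp (dvd_mul_left _ _) ?_
      exact (h.mul_right (v + d)).trans (dvd_of_eq (by ring))
    · refine hM.dvd_of_dvd_add (a := n * (m * (u + d) + 1) * u) hp (h.mul_right u) ?_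
      exact ⟨n * (u + d), by ring⟩
  obtain ⟨e, rfl⟩ := hd
  exact hM.dvd_of_dvd_add (a := n * d * (e * u)) hp (dvd_mul_diff.mul_right _) ⟨n, by ring⟩

theorem exists_modulus_dvd_iff {A : Set M} (hA : A ∈ S) {b m : M} (hm0 : m ≠ 0)
    (hm : ∀ d < b, d + 1 ∣ m) (x : M) :
    ∃ n, ∀ i < b, m * (i + 1) + 1 ∣ n ↔ i < x ∧ i ∈ A := by
  have : Nonempty S := ⟨⟨A, hA⟩⟩
  refine hM.sigma1_induction (P := fun x => ∃ n, ∀ i < b, m * (i + 1) + 1 ∣ n ↔ i < x ∧ i ∈ A)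
    (IsSigma1.exists hM (IsDelta0.isSigma1 (.forall_lt (.const b) (.iff
      (.dvd hM (.add (.mul (.const m) (.add (.var 0) (.const 1))) (.const 1)) (.var 1))
      (.and (.lt (.var 0) (.var 2)) (.mem hA (.var 0))))))) ⟨1, fun i _ => ?_⟩ ?_ x
  · refine iff_of_false (fun h => ?_) fun h => hM.not_lt_zero i h.1
    refine (hM.le_of_dvd one_ne_zero h).not_gt (lt_add_of_pos_left 1 ?_)
    exact mul_pos (hM.pos_iff_ne_zero.2 hm0) (hM.pos_iff_ne_zero.2 (hM.add_one_ne_zero i))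
  · rintro x ⟨n, hn⟩
    by_cases hx : x < b ∧ x ∈ A
    · refine ⟨n * (m * (x + 1) + 1), fun i hi => ?_⟩
      rw [hM.discrete, le_iff_lt_or_eq]
      obtain rfl | hix := eq_or_ne i x
      · exact iff_of_true (dvd_mul_left _ n) ⟨.inr rfl, hx.2⟩
      · simp only [hix, or_false, ← hn i hi]
        refine ⟨fun h => ?_, fun h => h.mul_right _⟩
        obtain ⟨d, hd, hid⟩ := hM.exists_difference hix
        exact hM.dvd_of_dvd_mul_modulus (hm d (hd.trans (max_lt hi hx.1))) hid h
    · refine ⟨n, fun i hi => (hn i hi).trans ?_⟩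
      rw [hM.discrete, le_iff_lt_or_eq]
      refine ⟨fun h => ⟨.inl h.1, h.2⟩, ?_⟩
      rintro ⟨h | rfl, hiA⟩
      · exact ⟨h, hiA⟩
      · exact absurd ⟨hi, hiA⟩ hx

theorem exists_finMem_iff {A : Set M} (hA : A ∈ S) (b : M) :
    ∃ c, ∀ i, FinMem i c ↔ i < b ∧ i ∈ A := by
  have : Nonempty S := ⟨⟨A, hA⟩⟩
  obtain ⟨m, hm0, hm⟩ := hM.exists_common_multiple b
  obtain ⟨n, hn⟩ := hM.exists_modulus_dvd_iff hA hm0 hm b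
  exact ⟨pair b (pair m n), fun i => hM.finMem_pair.trans <|
    and_congr_right fun hi => (hn i hi).trans (and_iff_right hi)⟩

theorem exists_finCode {A : Set M} (hA : A ∈ S) {b : M} (hb : ∀ i ∈ A, i < b) :
    ∃ c, IsFinCode c ∧ ∀ i, FinMem i c ↔ i ∈ A := by
  have : Nonempty S := ⟨⟨A, hA⟩⟩
  obtain ⟨c, hc⟩ := hM.exists_finMem_iff hA b
  obtain ⟨d, hd, hmin⟩ := hM.exists_least (P := fun d => ∀ i, FinMem i d ↔ FinMem i c)
    (.forall_finMem_iff hM (.var 0) (.const c) (fun _ _ => hM.lt_of_finMem)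
      (.finMem hM (.var 0) (.const c))) (x := c) fun _ => Iff.rfl
  refine ⟨d, fun e he => ?_, fun i => (hd i).trans ((hc i).trans (and_iff_right_of_imp (hb i)))⟩
  obtain ⟨i, hi⟩ := not_forall.1 (hmin e he)
  exact ⟨i, fun h => hi (h.trans (hd i))⟩

theorem Pf_mem {A : Set M} (hA : A ∈ S) : Pf A ∈ S :=
  have : Nonempty S := ⟨⟨A, hA⟩⟩
  hM.comprehension (.mem_Pf hM hA (.var 0))

theorem setOf_finMem_mem [Nonempty S] (c : M) : {i | FinMem i c} ∈ S :=
  hM.comprehension (.finMem hM (.var 0) (.const c))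

theorem exists_union_mem_Pf [Nonempty S] {A : Set M} {i j : M} (hi : i ∈ Pf A) (hj : j ∈ Pf A) :
    ∃ l ∈ Pf A, ∀ p, FinMem p l ↔ FinMem p i ∨ FinMem p j := by
  have union_mem : {p | FinMem p i ∨ FinMem p j} ∈ S :=
    hM.comprehension (.or (.finMem hM (.var 0) (.const i)) (.finMem hM (.var 0) (.const j)))
  obtain ⟨l, hl, hlp⟩ := hM.exists_finCode union_mem (b := max i j) fun p hp =>
    lt_max_iff.2 (hp.imp hM.lt_of_finMem hM.lt_of_finMem)
  exact ⟨l, ⟨hl, fun p hp => ((hlp p).1 hp).elim (hi.2 p) (hj.2 p)⟩, hlp⟩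

end ModelsRCA0

end Coding

section Spaces

variable {M : Type*} [CommSemiring M] [LinearOrder M] {S : Set (Set M)}

/-- The relation `L` between elements of `A` and elements of `B`, as a set of codes of pairs. -/
def codedRel (A B : Set M) (L : M → M → Prop) : Set M :=
  {z | ∃ a ∈ A, ∃ b ∈ B, z = pair a b ∧ L a b}

/-- The set `A` with the restriction of the relation `L` to it. -/
def relOn (A : Set M) (L : M → M → Prop) : RelSet M where
  carrier := A
  rel := codedRel A A L

/-- The second-countable space of sets `X` subject to `IsPoint`, with a subbasis indexed by the
elements `q` of `A`, the open set indexed by `q` consisting of the `X` with `C X q`. The basic open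
sets are the finite intersections. -/
def subbasicSpace (A : Set M) (IsPoint : Set M → Prop) (C : Set M → M → Prop) : SCSpace M where
  I := Pf A
  IsPoint := IsPoint
  Same X Y := X = Y
  InBasic X i := ∀ q, FinMem q i → C X q

omit [LinearOrder M] in
theorem codedRel_subset_cprod (A B : Set M) (L : M → M → Prop) : codedRel A B L ⊆ cprod A B :=
  fun _ ⟨a, ha, b, hb, h, _⟩ => ⟨a, ha, b, hb, h⟩

namespace ModelsRCA0

variable [IsStrictOrderedRing M] (hM : ModelsRCA0 S)
include hM

theorem pair_mem_codedRel {A B : Set M} {L : M → M → Prop} {a b : M} :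
    pair a b ∈ codedRel A B L ↔ a ∈ A ∧ b ∈ B ∧ L a b := by
  constructor
  · rintro ⟨a', ha, b', hb, h, hL⟩
    obtain ⟨rfl, rfl⟩ := hM.pair_inj.1 h
    exact ⟨ha, hb, hL⟩
  · rintro ⟨ha, hb, hL⟩
    exact ⟨a, ha, b, hb, rfl, hL⟩

theorem codedRel_mem {A B : Set M} (hA : A ∈ S) (hB : B ∈ S) {L : M → M → Prop}
    (hL : IsDelta0 S fun v : Fin 2 → M => L (v 1) (v 0)) : codedRel A B L ∈ S := by
  have : Nonempty S := ⟨⟨A, hA⟩⟩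
  refine hM.comprehension ((IsDelta0.exists_eq_pair hM
    (P := fun _ a b => a ∈ A ∧ b ∈ B ∧ L a b) (.var 0) (.and (.mem hA (.var 1))
      (.and (.mem hB (.var 0)) (hL.comp (t := fun i w => ![w 0, w 1] i)
        (Fin.forall_fin_two.2 ⟨.var 0, .var 1⟩))))).congr fun v => ⟨?_, ?_⟩)
  · rintro ⟨a, b, h, ha, hb, hL⟩
    exact ⟨a, ha, b, hb, h, hL⟩
  · rintro ⟨a, ha, b, hb, h, hL⟩
    exact ⟨a, b, h, ha, hb, hL⟩

theorem isQuasiOrder_relOn {A : Set M} (hA : A ∈ S) {L : M → M → Prop}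
    (hL : IsDelta0 S fun v : Fin 2 → M => L (v 1) (v 0)) (hrefl : ∀ x ∈ A, L x x)
    (htrans : ∀ x ∈ A, ∀ y ∈ A, ∀ z ∈ A, L x y → L y z → L x z) :
    IsQuasiOrder S (relOn A L) where
  carrier_mem := hA
  rel_mem := hM.codedRel_mem hA hA hL
  rel_subset := codedRel_subset_cprod A A L
  refl x hx := hM.pair_mem_codedRel.2 ⟨hx, hx, hrefl x hx⟩
  trans x hx y hy z hz hxy hyz := hM.pair_mem_codedRel.2 ⟨hx, hz, htrans x hx y hy z hz
    (hM.pair_mem_codedRel.1 hxy).2.2 (hM.pair_mem_codedRel.1 hyz).2.2⟩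

section Upper

variable {P : RelSet M}

theorem inBasic_upper {x i : M} : (upper P).InBasic x i ↔
    x ∈ P.carrier ∧ i ∈ Pf P.carrier ∧ ¬ ∃ p, FinMem p i ∧ P.Le x p :=
  hM.pair_mem_codedRel

theorem upper_U_mem (hA : P.carrier ∈ S) (hR : P.rel ∈ S) : (upper P).U ∈ S :=
  hM.codedRel_mem hA (hM.Pf_mem hA)
    (IsDelta0.exists_finMem hM (.var 0) (.mem hR (.pair (.var 2) (.var 0)))).not

theorem upper_k_mem (hA : P.carrier ∈ S) : (upper P).k ∈ S := by
  have : Nonempty S := ⟨⟨P.carrier, hA⟩⟩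
  have lt_sum (w : Fin 7 → M) (p : M) (hp : FinMem p (w 1) ∨ FinMem p (w 0)) : p < w 1 + w 0 :=
    hp.elim (fun h => (hM.lt_of_finMem h).trans_le (hM.le_add_right _ _))
      fun h => (hM.lt_of_finMem h).trans_le (hM.le_add_left _ _)
  refine hM.comprehension ((IsDelta0.exists_eq_pair hM (P := fun _ t l => ∃ x s, t = pair x s ∧
      ∃ i j, s = pair i j ∧ (x ∈ P.carrier ∧ i ∈ Pf P.carrier ∧ j ∈ Pf P.carrier ∧
        l ∈ Pf P.carrier ∧ ∀ p, FinMem p l ↔ FinMem p i ∨ FinMem p j)) (.var 0)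
    (.exists_eq_pair hM (.var 1) (.exists_eq_pair hM (.var 0) (.and (.mem hA (.var 3))
      (.and (.mem_Pf hM hA (.var 1)) (.and (.mem_Pf hM hA (.var 0))
      (.and (.mem_Pf hM hA (.var 4))
      (.forall_finMem_iff hM (.var 4) (.add (.var 1) (.var 0)) lt_sum
        (.or (.finMem hM (.var 0) (.var 2)) (.finMem hM (.var 0) (.var 1))))))))))).congr
    fun v => ⟨?_, ?_⟩)
  · rintro ⟨_, l, h, x, _, rfl, i, j, rfl, hx, hi, hj, hl, hu⟩
    exact ⟨x, hx, i, hi, j, hj, l, hl, h, hu⟩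
  · rintro ⟨x, hx, i, hi, j, hj, l, hl, h, hu⟩
    exact ⟨_, l, h, x, _, rfl, i, j, rfl, hx, hi, hj, hl, hu⟩

theorem pair_mem_upper_k {x i j l : M} : pair (pair x (pair i j)) l ∈ (upper P).k ↔
    (x ∈ P.carrier ∧ i ∈ Pf P.carrier ∧ j ∈ Pf P.carrier) ∧ l ∈ Pf P.carrier ∧
      ∀ p, FinMem p l ↔ FinMem p i ∨ FinMem p j := by
  constructor
  · rintro ⟨x', hx, i', hi, j', hj, l', hl, h, hu⟩
    simp only [hM.pair_inj] at h
    obtain ⟨⟨rfl, rfl, rfl⟩, rfl⟩ := h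
    exact ⟨⟨hx, hi, hj⟩, hl, hu⟩
  · rintro ⟨⟨hx, hi, hj⟩, hl, hu⟩
    exact ⟨x, hx, i, hi, j, hj, l, hl, rfl, hu⟩

theorem isFunction_upper_k [Nonempty S] : IsFunction (upper P).k
    (cprod P.carrier (cprod (Pf P.carrier) (Pf P.carrier))) (Pf P.carrier) := by
  constructor
  · rintro z ⟨x, hx, i, hi, j, hj, l, hl, rfl, -⟩
    exact ⟨_, ⟨x, hx, _, ⟨i, hi, j, hj, rfl⟩, rfl⟩, l, hl, rfl⟩
  · rintro _ ⟨x, hx, _, ⟨i, hi, j, hj, rfl⟩, rfl⟩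
    obtain ⟨l, hl, hu⟩ := hM.exists_union_mem_Pf hi hj
    refine ⟨l, hM.pair_mem_upper_k.2 ⟨⟨hx, hi, hj⟩, hl, hu⟩, fun l' h => ?_⟩
    obtain ⟨-, hl', hu'⟩ := hM.pair_mem_upper_k.1 h
    exact hl'.1.ext hl.1 fun p => (hu' p).trans (hu p).symm

theorem isSpace_upper (hA : P.carrier ∈ S) (hR : P.rel ∈ S) : (upper P).IsSpace S := by
  have : Nonempty S := ⟨⟨P.carrier, hA⟩⟩
  refine ⟨hA, hM.Pf_mem hA, hM.upper_U_mem hA hR, hM.upper_k_mem hA,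
    codedRel_subset_cprod _ _ _, hM.isFunction_upper_k, fun x hx => ?_, ?_⟩
  · exact ⟨0, hM.zero_mem_Pf _, hM.inBasic_upper.2
      ⟨hx, hM.zero_mem_Pf _, fun ⟨p, hp, _⟩ => hM.not_finMem_zero p hp⟩⟩
  · intro x hx i _ j _ hxi hxj l hl
    obtain ⟨⟨-, hi, hj⟩, hlP, hu⟩ := hM.pair_mem_upper_k.1 hl
    have inBasic_union_iff : ∀ y ∈ P.carrier,
        ((upper P).InBasic y l ↔ (upper P).InBasic y i ∧ (upper P).InBasic y j) := by
      intro y hy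
      simp only [hM.inBasic_upper, hy, hi, hj, hlP, true_and, hu, or_and_right, exists_or, not_or]
    exact ⟨(inBasic_union_iff x hx).2 ⟨hxi, hxj⟩, fun y hy => (inBasic_union_iff y hy).1⟩

end Upper

theorem isSpace_subbasicSpace {A : Set M} (hA : A ∈ S) (IsPoint : Set M → Prop)
    (C : Set M → M → Prop) : (subbasicSpace A IsPoint C).IsSpace S where
  I_mem := hM.Pf_mem hA
  cover _ _ _ := ⟨0, hM.zero_mem_Pf A, fun q hq => absurd hq (hM.not_finMem_zero q)⟩
  inter X _ _ i hi j hj hXi hXj := by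
    have : Nonempty S := ⟨⟨A, hA⟩⟩
    obtain ⟨l, hl, hu⟩ := hM.exists_union_mem_Pf hi hj
    exact ⟨l, hl, fun q hq => ((hu q).1 hq).elim (hXi q) (hXj q), fun Y _ hY =>
      ⟨fun q hq => hY q ((hu q).2 (.inl hq)), fun q hq => hY q ((hu q).2 (.inr hq))⟩⟩
  congr := by
    rintro X _ _ _ _ _ i _ hXi rfl
    exact hXi

end ModelsRCA0

end Spaces

section Transfer

variable {M : Type*} [CommSemiring M] [LinearOrder M] {S : Set (Set M)}

/-- The index `i` is listed in the code `g` of a sequence of effectively closed sets as one of the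
basic open sets whose union is the complement of the set `n`. -/
def Enumerates (g : Set M) (n i : M) : Prop := ∃ m c, pair (pair n m) c ∈ g ∧ FinMem i c

theorem CSCSpace.inClosed_iff {T : CSCSpace M} {g : Set M} {n x : M} :
    T.InClosed g n x ↔ x ∈ T.X ∧ ∀ i, Enumerates g n i → ¬ T.InBasic x i :=
  and_congr_right fun _ => ⟨fun h i ⟨m, c, hc, hi⟩ => h m c hc i hi,
    fun h m c hc i hi => h i ⟨m, c, hc, hi⟩⟩

theorem SCSpace.inClosed_iff {T : SCSpace M} {g : Set M} {n : M} {X : Set M} :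
    T.InClosed g n X ↔ T.IsPoint X ∧ ∀ i, Enumerates g n i → ¬ T.InBasic X i :=
  and_congr_right fun _ => ⟨fun h i ⟨m, c, hc, hi⟩ => h m c hc i hi,
    fun h m c hc i hi => h i ⟨m, c, hc, hi⟩⟩

namespace ModelsRCA0

variable [IsStrictOrderedRing M] (hM : ModelsRCA0 S)
include hM

theorem isSigma1_enumerates {g : Set M} (hg : g ∈ S) {r : ℕ} {s t : (Fin r → M) → M}
    (hs : IsTerm s) (ht : IsTerm t) : IsSigma1 S fun v => Enumerates g (s v) (t v) :=
  .exists hM (.exists hM (IsDelta0.isSigma1 (.and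
    (.mem hg (.pair (.pair hs.vecTail.vecTail (.var 1)) (.var 0)))
    (.finMem hM ht.vecTail.vecTail (.var 0)))))

theorem mem_of_enumerates {g I : Set M} (hg : IsFunction g (cprod Set.univ Set.univ) (Pf I))
    {n i : M} : Enumerates g n i → i ∈ I := fun ⟨_, _, hc, hi⟩ =>
  (hM.pair_mem_cprod.1 (hg.1 hc)).2.2 i hi

theorem exists_enumerates_iff_of_delta0 [Nonempty S] {B : Set M} {F : M → M → M → Prop}
    (hF : IsDelta0 S fun v : Fin 3 → M => F (v 2) (v 1) (v 0))
    (hlt : ∀ n q j, F n q j → j < q) (hB : ∀ n q j, F n q j → j ∈ B) :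
    ∃ g ∈ S, IsFunction g (cprod Set.univ Set.univ) (Pf B) ∧
      ∀ n j, Enumerates g n j ↔ ∃ q, F n q j := by
  let g : Set M := {z | ∃ t c, z = pair t c ∧
    ∃ n q, t = pair n q ∧ (IsFinCode c ∧ ∀ j, FinMem j c ↔ F n q j)}
  have g_mem : g ∈ S := hM.comprehension (IsDelta0.exists_eq_pair hM (.var 0)
    (.exists_eq_pair hM (.var 1) (.and (.isFinCode hM (.var 2))
      (.forall_finMem_iff hM (.var 2) (.var 0) (fun w j => hlt (w 1) (w 0) j)
        (hF.comp (t := fun i w => ![w 0, w 1, w 2] i)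
          fun i => by fin_cases i <;> exact .var _)))))
  have pair_mem_g {n q c : M} :
      pair (pair n q) c ∈ g ↔ IsFinCode c ∧ ∀ j, FinMem j c ↔ F n q j := by
    refine ⟨?_, fun hc => ⟨_, c, rfl, n, q, rfl, hc⟩⟩
    rintro ⟨t, c', h, n', q', rfl, hc⟩
    simp only [hM.pair_inj] at h
    obtain ⟨⟨rfl, rfl⟩, rfl⟩ := h
    exact hc
  have exists_pair_mem_g (n q : M) : ∃ c, pair (pair n q) c ∈ g := by
    obtain ⟨c, hc⟩ := hM.exists_finCode (A := {j | F n q j}) (hM.comprehension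
      (hF.comp (t := fun i w => ![w 0, q, n] i)
        fun i => by fin_cases i; exacts [.var 0, .const q, .const n])) (hlt n q)
    exact ⟨c, pair_mem_g.2 hc⟩
  refine ⟨g, g_mem, ⟨?_, ?_⟩, fun n j => ⟨?_, fun ⟨q, hj⟩ => ?_⟩⟩
  · rintro _ ⟨_, c, rfl, n, q, rfl, hc, h⟩
    exact hM.pair_mem_cprod.2
      ⟨⟨n, trivial, q, trivial, rfl⟩, hc, fun j hj => hB n q j ((h j).1 hj)⟩
  · rintro _ ⟨n, -, q, -, rfl⟩
    obtain ⟨c, hc⟩ := exists_pair_mem_g n q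
    refine ⟨c, hc, fun d hd => (pair_mem_g.1 hd).1.ext (pair_mem_g.1 hc).1 fun j => ?_⟩
    exact ((pair_mem_g.1 hd).2 j).trans ((pair_mem_g.1 hc).2 j).symm
  · rintro ⟨q, c, hc, hj⟩
    exact ⟨q, ((pair_mem_g.1 hc).2 j).1 hj⟩
  · obtain ⟨c, hc⟩ := exists_pair_mem_g n q
    exact ⟨q, c, hc, ((pair_mem_g.1 hc).2 j).2 hj⟩

theorem exists_enumerates_iff [Nonempty S] {B : Set M} {P : M → M → Prop}
    (hP : IsSigma1 S fun v : Fin 2 → M => P (v 1) (v 0)) (hB : ∀ n j, P n j → j ∈ B) :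
    ∃ g ∈ S, IsFunction g (cprod Set.univ Set.univ) (Pf B) ∧
      ∀ n j, Enumerates g n j ↔ P n j := by
  obtain ⟨R, hR, hPR⟩ := hP
  have P_iff (n j : M) : P n j ↔ ∃ y, R ![j, n] y := hPR ![j, n]
  obtain ⟨g, hg, hgB, hgF⟩ := hM.exists_enumerates_iff_of_delta0 (B := B)
    (F := fun n q j => j < q ∧ ∃ y < q, R ![j, n] y)
    (.and (.lt (.var 0) (.var 1)) (.exists_lt (.var 1)
      (hR.comp (t := fun i w => ![w 0, w 1, w 3] i) fun i => by fin_cases i <;> exact .var _)))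
    (fun n q j h => h.1) fun n q j ⟨_, y, _, hy⟩ => hB n j ((P_iff n j).2 ⟨y, hy⟩)
  refine ⟨g, hg, hgB, fun n j => (hgF n j).trans (.trans ⟨?_, ?_⟩ (P_iff n j).symm)⟩
  · rintro ⟨q, -, y, -, hy⟩
    exact ⟨y, hy⟩
  · rintro ⟨y, hy⟩
    exact ⟨max j y + 1, (hM.discrete _ _).2 (le_max_left j y), y,
      (hM.discrete _ _).2 (le_max_right j y), hy⟩

theorem inClosed_of_le {T : CSCSpace M} (hU : T.U ∈ S) {g : Set M} (hg : g ∈ S)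
    (hdesc : ∀ n x, T.InClosed g (n + 1) x → T.InClosed g n x) {k n x : M} (hkn : k ≤ n)
    (hx : T.InClosed g n x) : T.InClosed g k x := by
  have : Nonempty S := ⟨⟨g, hg⟩⟩
  have not_inClosed_iff (m : M) :
      ¬ T.InClosed g m x ↔ ∃ i, Enumerates g m i ∧ T.InBasic x i := by
    simp only [CSCSpace.inClosed_iff, hx.1, true_and, not_forall, not_not, exists_prop]
  obtain ⟨l, rfl⟩ := hM.exists_eq_add_of_le hkn
  by_contra hk
  refine hM.sigma1_induction (P := fun l => ¬ T.InClosed g (k + l) x) ?_ ?_ (fun l hl h => ?_) l hx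
  · simp only [not_inClosed_iff]
    exact .exists hM (.and hM (hM.isSigma1_enumerates hg (.add (.const k) (.var 1)) (.var 0))
      (IsDelta0.mem hU (.pair (.const x) (.var 0))).isSigma1)
  · rwa [add_zero]
  · exact hl (hdesc _ x (by rwa [add_assoc]))

/-- To keep the sequence descending in the large space as well, its set `n` omits the basic open
sets that correspond to those omitted from any of the sets `k ≤ n` of the given sequence. -/
theorem isNoetherian_of_embedding {T : CSCSpace M} {T' : SCSpace M} (hU : T.U ∈ S)
    {e : M → Set M} (he : ∀ x ∈ T.X, e x ∈ S) (hpoint : ∀ x ∈ T.X, T'.IsPoint (e x))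
    {R : M → M → Prop} (hR : IsDelta0 S fun v : Fin 2 → M => R (v 1) (v 0))
    (hRI : ∀ i j, R i j → j ∈ T'.I)
    (hbasic : ∀ x ∈ T.X, ∀ i ∈ T.I, T.InBasic x i ↔ ∃ j, R i j ∧ T'.InBasic (e x) j)
    (hT' : T'.IsNoetherian S) : T.IsNoetherian S := by
  intro g hg hgI hdesc
  have : Nonempty S := ⟨⟨g, hg⟩⟩
  obtain ⟨g', hg', hgI', henum⟩ := hM.exists_enumerates_iff (B := T'.I)
    (P := fun n j => ∃ k, k < n + 1 ∧ ∃ i, Enumerates g k i ∧ R i j)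
    (.exists hM (.and hM (IsDelta0.lt (.var 0) (.add (.var 2) (.const 1))).isSigma1
      (.exists hM (.and hM (hM.isSigma1_enumerates hg (.var 1) (.var 0))
        (hR.comp (t := fun i w => ![w 2, w 0] i)
          (Fin.forall_fin_two.2 ⟨.var 2, .var 0⟩)).isSigma1))))
    fun n j ⟨_, _, i, _, hij⟩ => hRI i j hij
  have inClosed_iff {x : M} (hx : x ∈ T.X) (n : M) :
      T'.InClosed g' n (e x) ↔ T.InClosed g n x := by
    rw [SCSpace.inClosed_iff]
    constructor
    · refine fun ⟨_, h⟩ => CSCSpace.inClosed_iff.2 ⟨hx, fun i hi hxi => ?_⟩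
      obtain ⟨j, hij, hxj⟩ := (hbasic x hx i (hM.mem_of_enumerates hgI hi)).1 hxi
      exact h j ((henum n j).2 ⟨n, lt_add_one n, i, hi, hij⟩) hxj
    · refine fun h => ⟨hpoint x hx, fun j hj hxj => ?_⟩
      obtain ⟨k, hk, i, hi, hij⟩ := (henum n j).1 hj
      have hxk := hM.inClosed_of_le hU hg hdesc ((hM.discrete k n).1 hk) h
      exact (CSCSpace.inClosed_iff.1 hxk).2 i hi
        ((hbasic x hx i (hM.mem_of_enumerates hgI hi)).2 ⟨j, hij, hxj⟩)
  obtain ⟨N, hN⟩ := hT' g' hg' hgI' fun n X _ h => by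
    rw [SCSpace.inClosed_iff] at h ⊢
    refine ⟨h.1, fun j hj => h.2 j ((henum (n + 1) j).2 ?_)⟩
    obtain ⟨k, hk, hij⟩ := (henum n j).1 hj
    exact ⟨k, hk.trans (lt_add_one _), hij⟩
  refine ⟨N, fun n hn x => ?_⟩
  by_cases hx : x ∈ T.X
  · rw [← inClosed_iff hx, ← inClosed_iff hx]
    exact hN n hn (e x) (he x hx)
  · exact iff_of_false (fun h => hx h.1) fun h => hx h.1

end ModelsRCA0

end Transfer

section Powersets

variable {M : Type*} [CommSemiring M] [LinearOrder M] {S : Set (Set M)}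

/-- The relation `a ≤^♭ b` between codes of finite sets. -/
def RelSet.FlatLe (Q : RelSet M) (a b : M) : Prop :=
  ∀ x, FinMem x a → ∃ y, FinMem y b ∧ Q.Le x y

/-- The relation `a ≤^♯ b` between codes of finite sets. -/
def RelSet.SharpLe (Q : RelSet M) (a b : M) : Prop :=
  ∀ y, FinMem y b → ∃ x, FinMem x a ∧ Q.Le x y

/-- The finite set `j` meets every member of the finite set `i` of finite sets. -/
def IsTransversal (i j : M) : Prop := ∀ p, FinMem p i → ∃ b, FinMem b p ∧ FinMem b j

namespace ModelsRCA0

variable [IsStrictOrderedRing M] (hM : ModelsRCA0 S) {Q : RelSet M}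
include hM

theorem isSpace_upperPFlat (hA : Q.carrier ∈ S) : (upperPFlat Q).IsSpace S :=
  hM.isSpace_subbasicSpace hA (· ⊆ Q.carrier) fun X q => ∃ p ∈ X, Q.Le q p

theorem isSpace_upperPSharp (hA : Q.carrier ∈ S) : (upperPSharp Q).IsSpace S :=
  hM.isSpace_subbasicSpace hA (· ⊆ Q.carrier) fun X q => ¬ ∃ p ∈ X, Q.Le p q

theorem isDelta0_flatLe (hR : Q.rel ∈ S) :
    IsDelta0 S fun v : Fin 2 → M => Q.FlatLe (v 1) (v 0) :=
  .forall_finMem hM (.var 1) (.exists_finMem hM (.var 1) (.mem hR (.pair (.var 1) (.var 0))))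

theorem isDelta0_sharpLe (hR : Q.rel ∈ S) :
    IsDelta0 S fun v : Fin 2 → M => Q.SharpLe (v 1) (v 0) :=
  .forall_finMem hM (.var 0) (.exists_finMem hM (.var 2) (.mem hR (.pair (.var 0) (.var 1))))

theorem isQuasiOrder_PfFlat (hQ : IsQuasiOrder S Q) : IsQuasiOrder S (PfFlat Q) := by
  refine hM.isQuasiOrder_relOn (L := Q.FlatLe) (hM.Pf_mem hQ.carrier_mem)
    (hM.isDelta0_flatLe hQ.rel_mem) (fun a ha x hx => ⟨x, hx, hQ.refl x (ha.2 x hx)⟩)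
    fun a ha b hb c hc hab hbc x hx => ?_
  obtain ⟨y, hy, hxy⟩ := hab x hx
  obtain ⟨z, hz, hyz⟩ := hbc y hy
  exact ⟨z, hz, hQ.trans x (ha.2 x hx) y (hb.2 y hy) z (hc.2 z hz) hxy hyz⟩

theorem isQuasiOrder_PfSharp (hQ : IsQuasiOrder S Q) : IsQuasiOrder S (PfSharp Q) := by
  refine hM.isQuasiOrder_relOn (L := Q.SharpLe) (hM.Pf_mem hQ.carrier_mem)
    (hM.isDelta0_sharpLe hQ.rel_mem) (fun a ha x hx => ⟨x, hx, hQ.refl x (ha.2 x hx)⟩)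
    fun a ha b hb c hc hab hbc z hz => ?_
  obtain ⟨y, hy, hyz⟩ := hbc z hz
  obtain ⟨x, hx, hxy⟩ := hab y hy
  exact ⟨x, hx, hQ.trans x (ha.2 x hx) y (hb.2 y hy) z (hc.2 z hz) hxy hyz⟩

theorem PfFlat_le {a b : M} : (PfFlat Q).Le a b ↔
    a ∈ Pf Q.carrier ∧ b ∈ Pf Q.carrier ∧ Q.FlatLe a b :=
  hM.pair_mem_codedRel

theorem PfSharp_le {a b : M} : (PfSharp Q).Le a b ↔
    a ∈ Pf Q.carrier ∧ b ∈ Pf Q.carrier ∧ Q.SharpLe a b :=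
  hM.pair_mem_codedRel

/-- An upward closed set is the union of the upward closures of its elements. -/
theorem inBasic_upper_PfFlat_iff (hQ : IsQuasiOrder S Q) {a i : M} (ha : a ∈ Pf Q.carrier) :
    (upper (PfFlat Q)).InBasic a i ↔
      ∃ j, (upper (PfFlat Q)).InBasic j i ∧ (upperPFlat Q).InBasic {x | FinMem x a} j := by
  constructor
  · exact fun h => ⟨a, h, fun x hx => ⟨x, hx, hQ.refl x (ha.2 x hx)⟩⟩
  · rintro ⟨j, hji, hja⟩
    obtain ⟨hj, hi, hji⟩ := hM.inBasic_upper.1 hji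
    refine hM.inBasic_upper.2 ⟨ha, hi, fun ⟨p, hp, hap⟩ => hji ⟨p, hp, ?_⟩⟩
    exact (hM.isQuasiOrder_PfFlat hQ).trans j hj a ha p (hi.2 p hp)
      (hM.PfFlat_le.2 ⟨hj, ha, hja⟩) hap

theorem not_PfSharp_le_of_isTransversal {a i j : M} (hj : IsTransversal i j)
    (haj : (upperPSharp Q).InBasic {x | FinMem x a} j) {p : M} (hp : FinMem p i) :
    ¬ (PfSharp Q).Le a p := fun hap =>
  let ⟨b, hbp, hbj⟩ := hj p hp
  haj b hbj ((hM.PfSharp_le.1 hap).2.2 b hbp)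

/-- The transversal consists of the elements of members of `i` that have no lower bound in `a`. -/
theorem exists_isTransversal (hA : Q.carrier ∈ S) (hR : Q.rel ∈ S) {a i : M}
    (hai : (upper (PfSharp Q)).InBasic a i) :
    ∃ j ∈ Pf Q.carrier, IsTransversal i j ∧ (upperPSharp Q).InBasic {x | FinMem x a} j := by
  have : Nonempty S := ⟨⟨_, hA⟩⟩
  obtain ⟨ha, hi, hai⟩ := hM.inBasic_upper.1 hai
  let B : Set M := {b | ∃ p, FinMem p i ∧ (FinMem b p ∧ ¬ ∃ x, FinMem x a ∧ Q.Le x b)}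
  have B_mem : B ∈ S := hM.comprehension (.exists_finMem hM (.const i) (.and
    (.finMem hM (.var 1) (.var 0)) (IsDelta0.not (.exists_finMem hM (.const a)
      (.mem hR (.pair (.var 0) (.var 2)))))))
  obtain ⟨j, hj, hjB⟩ := hM.exists_finCode B_mem (b := i) fun b ⟨p, hp, hb, _⟩ =>
    (hM.lt_of_finMem hb).trans (hM.lt_of_finMem hp)
  refine ⟨j, ⟨hj, fun b hb => ?_⟩, fun p hp => ?_, fun b hb => ?_⟩
  · obtain ⟨p, hp, hbp, -⟩ := (hjB b).1 hb
    exact (hi.2 p hp).2 b hbp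
  · by_contra! no_common_element
    refine hai ⟨p, hp, hM.PfSharp_le.2 ⟨ha, hi.2 p hp, fun b hb => ?_⟩⟩
    by_contra hab
    exact no_common_element b hb ((hjB b).2 ⟨p, hp, hb, hab⟩)
  · obtain ⟨p, -, -, hab⟩ := (hjB b).1 hb
    exact hab

theorem inBasic_upper_PfSharp_iff (hA : Q.carrier ∈ S) (hR : Q.rel ∈ S) {a i : M}
    (ha : a ∈ Pf Q.carrier) (hi : i ∈ Pf (Pf Q.carrier)) :
    (upper (PfSharp Q)).InBasic a i ↔ ∃ j, (j ∈ Pf Q.carrier ∧ IsTransversal i j) ∧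
      (upperPSharp Q).InBasic {x | FinMem x a} j := by
  constructor
  · intro h
    obtain ⟨j, hj, hij, haj⟩ := hM.exists_isTransversal hA hR h
    exact ⟨j, ⟨hj, hij⟩, haj⟩
  · rintro ⟨j, ⟨-, hij⟩, haj⟩
    exact hM.inBasic_upper.2
      ⟨ha, hi, fun ⟨_, hp, hap⟩ => hM.not_PfSharp_le_of_isTransversal hij haj hp hap⟩

theorem isNoetherian_upper_PfFlat (hQ : IsQuasiOrder S Q) (hN : (upperPFlat Q).IsNoetherian S) :
    (upper (PfFlat Q)).IsNoetherian S := by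
  have : Nonempty S := ⟨⟨_, hQ.carrier_mem⟩⟩
  have hPf := hM.isQuasiOrder_PfFlat hQ
  have hU := hM.upper_U_mem hPf.carrier_mem hPf.rel_mem
  exact hM.isNoetherian_of_embedding hU (e := fun a => {x | FinMem x a})
    (fun a _ => hM.setOf_finMem_mem a) (fun a ha => ha.2)
    (R := fun i j => (upper (PfFlat Q)).InBasic j i) (.mem hU (.pair (.var 0) (.var 1)))
    (fun i j h => (hM.inBasic_upper.1 h).1)
    (fun a ha i _ => hM.inBasic_upper_PfFlat_iff hQ ha) hN

theorem isNoetherian_upper_PfSharp (hA : Q.carrier ∈ S) (hR : Q.rel ∈ S)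
    (hN : (upperPSharp Q).IsNoetherian S) : (upper (PfSharp Q)).IsNoetherian S := by
  have : Nonempty S := ⟨⟨_, hA⟩⟩
  have hPf := hM.Pf_mem hA
  have hU := hM.upper_U_mem (P := PfSharp Q) hPf
    (hM.codedRel_mem hPf hPf (hM.isDelta0_sharpLe hR))
  exact hM.isNoetherian_of_embedding hU
    (e := fun a => {x | FinMem x a}) (fun a _ => hM.setOf_finMem_mem a) (fun a ha => ha.2)
    (R := fun i j => j ∈ Pf Q.carrier ∧ IsTransversal i j)
    (.and (.mem_Pf hM hA (.var 0)) (.forall_finMem hM (.var 1)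
      (.exists_finMem hM (.var 0) (.finMem hM (.var 0) (.var 2)))))
    (fun i j h => h.1)
    (fun a ha i hi => hM.inBasic_upper_PfSharp_iff hA hR ha hi) hN

end ModelsRCA0

end Powersets

end SOA

theorem theorem3p13 {M : Type*} [CommSemiring M] [LinearOrder M] [IsStrictOrderedRing M]
    (S : Set (Set M)) (hM : SOA.ModelsRCA0 S) (Q : SOA.RelSet M) (hQ : SOA.IsQuasiOrder S Q) :
    ((SOA.upperPFlat Q).IsSpace S ∧ SOA.IsQuasiOrder S (SOA.PfFlat Q) ∧
      (SOA.upper (SOA.PfFlat Q)).IsSpace S ∧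
      ((SOA.upperPFlat Q).IsNoetherian S → (SOA.upper (SOA.PfFlat Q)).IsNoetherian S)) ∧
    ((SOA.upperPSharp Q).IsSpace S ∧ SOA.IsQuasiOrder S (SOA.PfSharp Q) ∧
      (SOA.upper (SOA.PfSharp Q)).IsSpace S ∧
      ((SOA.upperPSharp Q).IsNoetherian S → (SOA.upper (SOA.PfSharp Q)).IsNoetherian S)) := by
  have hFlat := hM.isQuasiOrder_PfFlat hQ
  have hSharp := hM.isQuasiOrder_PfSharp hQ
  exact ⟨⟨hM.isSpace_upperPFlat hQ.carrier_mem, hFlat,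
      hM.isSpace_upper hFlat.carrier_mem hFlat.rel_mem, hM.isNoetherian_upper_PfFlat hQ⟩,
    ⟨hM.isSpace_upperPSharp hQ.carrier_mem, hSharp,
      hM.isSpace_upper hSharp.carrier_mem hSharp.rel_mem,
      hM.isNoetherian_upper_PfSharp hQ.carrier_mem hQ.rel_mem⟩⟩
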